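/- For each integer $n\ge 0$ let $SG(n)$ be the two-dimensional Sierpinski gasket graph at stage $n$: $SG(0)$ is a triangle, with leftmost vertex $o$, rightmost vertex $a_0$ and topmost vertex $b_0$; and $SG(n+1)$ is obtained by juxtaposing three copies of $SG(n)$ in the plane, namely $SG(n)$ itself, its translate whose leftmost vertex is $a_n$, and its translate whose leftmost vertex is $b_n$ (so that any two of the copies share exactly one corner vertex). Here $o$, $a_n$, $b_n$ denote the leftmost, rightmost and topmost corner of $SG(n)$. A spanning subgraph of $SG(n)$ is a subgraph with the same vertex set. Let $f(n)$ be the number of spanning trees of $SG(n)$, and for a vertex $x$ let $f_j(n,x)$ be the number of spanning trees in which $x$ has degree exactly $j$. Let $g(n)$ be the number of spanning subgraphs of $SG(n)$ that consist of exactly two trees (a tree may be a single isolated vertex), one of them containing $b_n$ and the other containing both $o$ and $a_n$, and let $g_i(n,x)$ be the number of those in which $x$ has degree exactly $i$. Put $F_j(n,x)=f_j(n,x)/f(n)$ and $G_i(n,x)=g_i(n,x)/g(n)$. Then for every integer $n\ge 0$, \[ F_1(n,o)=\frac{11}{14}-\frac{5}{42}\Bigl(\frac1{15}\Bigr)^n,\qquad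 F_2(n,o)=\frac{3}{14}+\frac{5}{42}\Bigl(\frac1{15}\Bigr)^n, \] \[ G_1(n,o)=\frac{11}{14}+\frac{3}{14}\Bigl(\frac1{15}\Bigr)^n,\qquad G_2(n,o)=\frac{3}{14}-\frac{3}{14}\Bigl(\frac1{15}\Bigr)^n. \] -/

import Mathlib

/-! The Sierpinski gasket graphs are realized in the lattice coordinates `(i, j)`, standing for the
point `i • u + j • v` of the plane, where `u` and `v` are the unit vectors at angles `0` and `60`
degrees.  Thus `SG(n)` is a triangle of side length `2 ^ n` whose leftmost vertex `o` is the
origin. -/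

namespace SierpinskiGasket

/-- The vertices of `SG(n)`: three copies of the previous stage, of side length `2 ^ n`, are
juxtaposed to form stage `n + 1`. -/
def verts : ℕ → Finset (ℕ × ℕ)
  | 0 => {(0, 0), (1, 0), (0, 1)}
  | n + 1 => verts n ∪ (verts n).image (fun p => (p.1 + 2 ^ n, p.2)) ∪
      (verts n).image (fun p => (p.1, p.2 + 2 ^ n))

/-- The edges of `SG(n)`, as a graph on the whole lattice: stage `0` is a triangle, and stage
`n + 1` consists of the edges of three copies of stage `n`. -/
def latticeGraph : ℕ → SimpleGraph (ℕ × ℕ)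
  | 0 => SimpleGraph.fromRel (fun p q => p ∈ verts 0 ∧ q ∈ verts 0)
  | n + 1 => latticeGraph n ⊔ (latticeGraph n).map (fun p => (p.1 + 2 ^ n, p.2)) ⊔
      (latticeGraph n).map (fun p => (p.1, p.2 + 2 ^ n))

/-- The vertex type of `SG(n)`. -/
abbrev Vert (n : ℕ) : Type := {p : ℕ × ℕ // p ∈ verts n}

/-- The two-dimensional Sierpinski gasket graph `SG(n)`. -/
def SG (n : ℕ) : SimpleGraph (Vert n) :=
  (latticeGraph n).comap Subtype.val

theorem corner_mem (n : ℕ) :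
    (0, 0) ∈ verts n ∧ (2 ^ n, 0) ∈ verts n ∧ (0, 2 ^ n) ∈ verts n := by
  induction n with
  | zero => simp [verts]
  | succ n ih =>
    obtain ⟨h0, h1, h2⟩ := ih
    refine ⟨?_, ?_, ?_⟩ <;> simp only [verts, Finset.mem_union, Finset.mem_image]
    · exact Or.inl (Or.inl h0)
    · exact Or.inl (Or.inr ⟨_, h1, by simp [pow_succ, mul_two]⟩)
    · exact Or.inr ⟨_, h2, by simp [pow_succ, mul_two]⟩

/-- The leftmost vertex `o` of `SG(n)`. -/
def o (n : ℕ) : Vert n := ⟨(0, 0), (corner_mem n).1⟩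

/-- The rightmost vertex `a_n` of `SG(n)`. -/
def a (n : ℕ) : Vert n := ⟨(2 ^ n, 0), (corner_mem n).2.1⟩

/-- The topmost vertex `b_n` of `SG(n)`. -/
def b (n : ℕ) : Vert n := ⟨(0, 2 ^ n), (corner_mem n).2.2⟩

/-- The spanning trees of `SG(n)`.  A spanning subgraph is a graph `T ≤ SG n` on the same
vertices. -/
def spanningTrees (n : ℕ) : Set (SimpleGraph (Vert n)) :=
  {T | T ≤ SG n ∧ T.IsTree}

/-- The spanning subgraphs of `SG(n)` that consist of two trees (one of which may be an isolated
vertex), one containing `b_n` and the other containing both `o` and `a_n`. -/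
def twoTrees (n : ℕ) : Set (SimpleGraph (Vert n)) :=
  {T | T ≤ SG n ∧ T.IsAcyclic ∧ Nat.card T.ConnectedComponent = 2 ∧
    T.Reachable (o n) (a n) ∧ ¬ T.Reachable (o n) (b n)}

/-- The number of bonds of `T` at the vertex `x`. -/
noncomputable def bonds {n : ℕ} (T : SimpleGraph (Vert n)) (x : Vert n) : ℕ :=
  (T.neighborSet x).ncard

/-- `f(n)`: the number of spanning trees of `SG(n)`. -/
noncomputable def numF (n : ℕ) : ℕ := (spanningTrees n).ncard

/-- `f_j(n, x)`: the number of spanning trees of `SG(n)` with exactly `j` bonds at `x`. -/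
noncomputable def numFAt (j n : ℕ) (x : Vert n) : ℕ :=
  {T ∈ spanningTrees n | bonds T x = j}.ncard

/-- `g(n)`: the number of two-tree spanning subgraphs separating `b_n` from `o` and `a_n`. -/
noncomputable def numG (n : ℕ) : ℕ := (twoTrees n).ncard

/-- `g_i(n, x)`: the number of those with exactly `i` bonds at `x`. -/
noncomputable def numGAt (i n : ℕ) (x : Vert n) : ℕ :=
  {T ∈ twoTrees n | bonds T x = i}.ncard

/-- The probability `F_j(n, x) = f_j(n, x) / f(n)`. -/
noncomputable def F (j n : ℕ) (x : Vert n) : ℝ := (numFAt j n x : ℝ) / (numF n : ℝ)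

/-- The probability `G_i(n, x) = g_i(n, x) / g(n)`. -/
noncomputable def G (i n : ℕ) (x : Vert n) : ℝ := (numGAt i n x : ℝ) / (numG n : ℝ)

end SierpinskiGasket

/-! Cut `SG(n + 1)` into its three copies of `SG(n)`. A spanning forest each of whose trees contains
a corner restricts to such forests on the copies, and whether three forests glue back to one, and
how it connects the outer corners, depends only on the partitions of the corners that they induce.
Acyclicity enters through a count: a graph is acyclic when its edges and components together are as
many as its vertices. This gives recursions for the numbers `f`, `g`, `h` of forests with one, two
and three trees, also when the degree of `o` is prescribed, since `o` lies in a single copy.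

The relation `f h = 3 g²` is preserved by the recursion. It turns the recursion of the probabilities
into the linear map `(F, G) ↦ ((2 F + G) / 3, (3 F + 2 G) / 5)`, which preserves `9 F + 5 G` and
contracts `F - G` by the factor `1 / 15`. -/

namespace SierpinskiGasket

section Merge

variable {α β : Type*} [DecidableEq β]

/-- The union step of a union-find algorithm: the labelling `f` of a partition is changed so that
the class of `e.1` is absorbed in the class of `e.2`. -/
def merge (f : α → β) (e : α × α) : α → β :=
  fun z => if f z = f e.1 then f e.2 else f z

theorem ker_merge_le_iff {f : α → β} {e : α × α} {r : Setoid α} :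
    Setoid.ker (merge f e) ≤ r ↔ Setoid.ker f ≤ r ∧ r e.1 e.2 := by
  constructor
  · intro h
    refine ⟨fun x y (hxy : f x = f y) => h ?_, h ?_⟩
    · simp only [Setoid.ker_def, merge, hxy]
    · simp only [Setoid.ker_def, merge, if_true, ite_self]
  · rintro ⟨hf, he⟩ x y hxy
    simp only [Setoid.ker_def, merge] at hxy
    split_ifs at hxy with hx hy hy
    · exact hf (hx.trans hy.symm)
    · exact r.trans (r.trans (hf hx) he) (hf hxy)
    · exact r.trans (hf hxy) (r.symm (r.trans (hf hy) he))
    · exact hf hxy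

theorem ker_foldl_merge_le_iff {f : α → β} {E : List (α × α)} {r : Setoid α} :
    Setoid.ker (E.foldl merge f) ≤ r ↔ Setoid.ker f ≤ r ∧ ∀ e ∈ E, r e.1 e.2 := by
  induction E generalizing f with
  | nil => simp
  | cons e E ih => rw [List.foldl_cons, ih, ker_merge_le_iff, List.forall_mem_cons, and_assoc]

theorem range_merge {f : α → β} {e : α × α} (he : f e.1 ≠ f e.2) :
    Set.range (merge f e) = Set.range f \ {f e.1} := by
  ext y
  constructor
  · rintro ⟨z, rfl⟩
    by_cases hz : f z = f e.1
    · simp [merge, hz, he.symm]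
    · simp [merge, hz]
  · rintro ⟨⟨z, rfl⟩, hz⟩
    exact ⟨z, if_neg hz⟩

end Merge

section Forest

variable {V : Type*} {T : SimpleGraph V} {u v : V}

theorem reachableSetoid_le_iff {r : Setoid V} :
    T.reachableSetoid ≤ r ↔ ∀ u v, T.Adj u v → r u v := by
  refine ⟨fun h u v huv => h huv.reachable, fun h u v huv => ?_⟩
  obtain ⟨p⟩ := huv
  induction p with
  | nil => exact r.refl _
  | cons huv _ ih => exact r.trans (h _ _ huv) ih

theorem ker_connectedComponentMk (T : SimpleGraph V) :
    Setoid.ker T.connectedComponentMk = T.reachableSetoid :=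
  Setoid.ext fun _ _ => SimpleGraph.ConnectedComponent.eq

open Classical in
theorem reachableSetoid_sup_edge (T : SimpleGraph V) (u v : V) :
    (T ⊔ SimpleGraph.edge u v).reachableSetoid =
      Setoid.ker (merge T.connectedComponentMk (u, v)) := by
  refine eq_of_forall_ge_iff fun r => ?_
  rw [ker_merge_le_iff, ker_connectedComponentMk, reachableSetoid_le_iff, reachableSetoid_le_iff]
  simp only [SimpleGraph.sup_adj, SimpleGraph.edge_adj]
  constructor
  · intro h
    refine ⟨fun x y hxy => h x y (.inl hxy), ?_⟩
    rcases eq_or_ne u v with rfl | huv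
    · exact r.refl u
    · exact h u v (.inr ⟨.inl ⟨rfl, rfl⟩, huv⟩)
  · rintro ⟨h, huv⟩ x y (hxy | ⟨⟨rfl, rfl⟩ | ⟨rfl, rfl⟩, -⟩)
    exacts [h x y hxy, huv, r.symm huv]

theorem card_connectedComponent_sup_edge_of_reachable (h : T.Reachable u v) :
    Nat.card (T ⊔ SimpleGraph.edge u v).ConnectedComponent = Nat.card T.ConnectedComponent := by
  have hr : (T ⊔ SimpleGraph.edge u v).reachableSetoid = T.reachableSetoid := by
    refine eq_of_forall_ge_iff fun r => ?_
    classical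
    rw [reachableSetoid_sup_edge, ker_merge_le_iff, ker_connectedComponentMk]
    exact and_iff_left_of_imp fun hle => hle h
  exact congrArg (fun r => Nat.card (Quotient r)) hr

theorem card_connectedComponent_sup_edge_of_not_reachable [Finite V] (h : ¬ T.Reachable u v) :
    Nat.card (T ⊔ SimpleGraph.edge u v).ConnectedComponent + 1 =
      Nat.card T.ConnectedComponent := by
  classical
  have hne : T.connectedComponentMk u ≠ T.connectedComponentMk v :=
    mt SimpleGraph.ConnectedComponent.exact h
  have hsurj : Function.Surjective T.connectedComponentMk := Quot.mk_surjective
  have hr : Nat.card (T ⊔ SimpleGraph.edge u v).ConnectedComponent =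
      (Set.range T.connectedComponentMk \ {T.connectedComponentMk u}).ncard := by
    rw [← range_merge (e := (u, v)) hne, ← Nat.card_coe_set_eq,
      ← Nat.card_congr (Setoid.quotientKerEquivRange _), ← reachableSetoid_sup_edge]
    rfl
  rw [hr, Set.ncard_sdiff_singleton_add_one (Set.mem_range_self u),
    hsurj.range_eq, Set.ncard_univ]

theorem ncard_edgeSet_sup_edge [Finite V] (huv : u ≠ v) (h : ¬ T.Adj u v) :
    (T ⊔ SimpleGraph.edge u v).edgeSet.ncard = T.edgeSet.ncard + 1 := by
  rw [SimpleGraph.edgeSet_sup, SimpleGraph.edgeSet_edge_of_ne huv, Set.union_singleton,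
    Set.ncard_insert_of_notMem (mt T.mem_edgeSet.1 h)]

theorem sup_edge_induction [Finite V] {motive : SimpleGraph V → Prop} (bot : motive ⊥)
    (sup_edge : ∀ T u v, u ≠ v → ¬ T.Adj u v → motive T → motive (T ⊔ SimpleGraph.edge u v))
    (T : SimpleGraph V) : motive T := by
  induction T using WellFoundedLT.induction with
  | ind T ih =>
    rcases eq_or_ne T ⊥ with rfl | hT
    · exact bot
    · obtain ⟨u, v, huv⟩ := SimpleGraph.ne_bot_iff_exists_adj.1 hT
      have hadj : ¬ (T \ SimpleGraph.edge u v).Adj u v := by simp [SimpleGraph.edge_adj, huv.ne]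
      have hT : T \ SimpleGraph.edge u v ⊔ SimpleGraph.edge u v = T :=
        sdiff_sup_cancel ((SimpleGraph.edge_le_iff T).2 (.inr huv))
      have hlt := SimpleGraph.lt_sup_edge _ u v huv.ne hadj
      rw [hT] at hlt
      rw [← hT]
      exact sup_edge _ u v huv.ne hadj (ih _ hlt)

theorem card_connectedComponent_bot :
    Nat.card (⊥ : SimpleGraph V).ConnectedComponent = Nat.card V :=
  (Nat.card_congr (.ofBijective (⊥ : SimpleGraph V).connectedComponentMk
    ⟨fun _ _ h => SimpleGraph.reachable_bot.1 (SimpleGraph.ConnectedComponent.exact h),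
      Quot.mk_surjective⟩)).symm

theorem card_le_ncard_edgeSet_add_card_connectedComponent [Finite V] (T : SimpleGraph V) :
    Nat.card V ≤ T.edgeSet.ncard + Nat.card T.ConnectedComponent := by
  induction T using sup_edge_induction with
  | bot => simp [card_connectedComponent_bot]
  | sup_edge T u v huv hadj ih =>
    rw [ncard_edgeSet_sup_edge huv hadj]
    by_cases hr : T.Reachable u v
    · rw [card_connectedComponent_sup_edge_of_reachable hr]
      lia
    · have hcard := card_connectedComponent_sup_edge_of_not_reachable hr
      lia

theorem isAcyclic_iff_ncard_edgeSet_add_card_connectedComponent [Finite V] :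
    T.IsAcyclic ↔ T.edgeSet.ncard + Nat.card T.ConnectedComponent = Nat.card V := by
  induction T using sup_edge_induction with
  | bot => simp [card_connectedComponent_bot]
  | sup_edge T u v huv hadj ih =>
    rw [SimpleGraph.isAcyclic_sup_fromEdgeSet_iff, ih, ncard_edgeSet_sup_edge huv hadj]
    by_cases hr : T.Reachable u v
    · have hle := card_le_ncard_edgeSet_add_card_connectedComponent T
      simp only [hr, huv, hadj, card_connectedComponent_sup_edge_of_reachable hr]
      lia
    · have hcard := card_connectedComponent_sup_edge_of_not_reachable hr
      simp only [hr, false_implies, and_true]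
      lia

end Forest

section CornerForest

variable {ι V : Type*} {T : SimpleGraph V} {c : ι → V}

/-- The partition of the corners `c k` induced by the components of `T`. -/
def cornerPartition (T : SimpleGraph V) (c : ι → V) : Setoid ι :=
  T.reachableSetoid.comap c

/-- A spanning forest each of whose trees contains one of the corners `c k`. -/
structure IsCornerForest (T : SimpleGraph V) (c : ι → V) : Prop where
  isAcyclic : T.IsAcyclic
  exists_reachable : ∀ v, ∃ k, T.Reachable (c k) v

theorem card_quotient_cornerPartition_eq_iff [Finite V] :
    Nat.card (Quotient (cornerPartition T c)) = Nat.card T.ConnectedComponent ↔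
      ∀ v, ∃ k, T.Reachable (c k) v := by
  have hcard : Nat.card (Quotient (cornerPartition T c)) =
      (Set.range (T.connectedComponentMk ∘ c)).ncard := by
    rw [cornerPartition, ← ker_connectedComponentMk]
    exact Nat.card_congr (Setoid.quotientKerEquivRange _)
  rw [hcard, ← Set.eq_univ_iff_ncard, Set.range_eq_univ]
  exact Quot.mk_surjective.forall.trans (forall_congr' fun v => exists_congr fun k =>
    SimpleGraph.ConnectedComponent.eq)

theorem isAcyclic_iff_card_quotient_cornerPartition [Finite V]
    (h : ∀ v, ∃ k, T.Reachable (c k) v) : T.IsAcyclic ↔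
      T.edgeSet.ncard + Nat.card (Quotient (cornerPartition T c)) = Nat.card V := by
  rw [isAcyclic_iff_ncard_edgeSet_add_card_connectedComponent,
    card_quotient_cornerPartition_eq_iff.2 h]

theorem isTree_iff_isCornerForest [Nonempty ι] :
    T.IsTree ↔ IsCornerForest T c ∧ cornerPartition T c = ⊤ := by
  constructor
  · intro hT
    have k : ι := Classical.arbitrary ι
    exact ⟨⟨hT.isAcyclic, fun v => ⟨k, hT.connected.preconnected _ v⟩⟩,
      Setoid.eq_top_iff.2 fun k l => hT.connected.preconnected _ _⟩
  · rintro ⟨hT, htop⟩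
    have hpre : T.Preconnected := by
      intro u v
      obtain ⟨k, hk⟩ := hT.exists_reachable u
      obtain ⟨l, hl⟩ := hT.exists_reachable v
      exact hk.symm.trans ((Setoid.eq_top_iff.1 htop k l : T.Reachable _ _).trans hl)
    have : Nonempty V := .map c ‹_›
    exact ⟨⟨hpre⟩, hT.isAcyclic⟩

/-- The spanning subgraphs of `G` that are forests, with each tree containing a corner, and connect
the corners according to the partition `p`. -/
def cornerForests (G : SimpleGraph V) (c : ι → V) (p : Setoid ι) : Set (SimpleGraph V) :=
  {T | T ≤ G ∧ IsCornerForest T c ∧ cornerPartition T c = p}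

theorem mem_cornerForests_of_surjective [Finite V] {G : SimpleGraph V} {p : Setoid ι}
    (hc : Function.Surjective c) : T ∈ cornerForests G c p ↔
      T ≤ G ∧ T.edgeSet.ncard + Nat.card (Quotient p) = Nat.card V ∧ cornerPartition T c = p := by
  have hreach : ∀ v, ∃ k, T.Reachable (c k) v := hc.forall.2 fun k => ⟨k, .refl _⟩
  refine and_congr_right fun _ => ⟨?_, ?_⟩
  · rintro ⟨hT, rfl⟩
    exact ⟨(isAcyclic_iff_card_quotient_cornerPartition hreach).1 hT.isAcyclic, rfl⟩
  · rintro ⟨hcard, rfl⟩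
    exact ⟨⟨(isAcyclic_iff_card_quotient_cornerPartition hreach).2 hcard, hreach⟩, rfl⟩

end CornerForest

section Amalgam

variable {ι : Type*}

/-- Partitions `p k` of the corners of copies indexed by `k : ι` generate a partition of the
identified corners, where `s(k, l)` stands for the corner `l` of the copy `k`, which is the same as
the corner `k` of the copy `l`. -/
def amalgam (p : ι → Setoid ι) : Setoid (Sym2 ι) :=
  ⨆ k, (p k).map fun l => s(k, l)

theorem amalgam_le_iff {p : ι → Setoid ι} {r : Setoid (Sym2 ι)} :
    amalgam p ≤ r ↔ ∀ k l l', p k l l' → r s(k, l) s(k, l') := by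
  rw [amalgam, iSup_le_iff]
  refine forall_congr' fun k => ⟨fun h l l' hl => h (.rel _ _ ⟨l, l', hl, rfl, rfl⟩), fun h => ?_⟩
  refine Setoid.eqvGen_le ?_
  rintro _ _ ⟨l, l', hl, rfl, rfl⟩
  exact h l l' hl

theorem amalgam_of_rel {p : ι → Setoid ι} {k l l' : ι} (h : p k l l') :
    amalgam p s(k, l) s(k, l') :=
  amalgam_le_iff.1 le_rfl k l l' h

/-- Forests on the copies that connect the corners according to `p` glue to a forest that connects
the outer corners `s(k, k)` according to `q`. The last condition rules out cycles. -/
structure Glues [Fintype ι] (p : ι → Setoid ι) (q : Setoid ι) : Prop where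
  comap_diag : (amalgam p).comap Sym2.diag = q
  exists_diag : ∀ x, ∃ k, amalgam p (Sym2.diag k) x
  sum_card : ∑ k, Nat.card (Quotient (p k)) =
    (Fintype.card ι).choose 2 + Nat.card (Quotient q)

end Amalgam

section Gluing

theorem choose_two_add_choose_succ_two (n : ℕ) :
    n.choose 2 + (n + 1).choose 2 = n * n := by
  induction n with
  | zero => rfl
  | succ n ih =>
    have h1 := Nat.choose_succ_succ' n 1
    have h2 := Nat.choose_succ_succ' (n + 1) 1
    simp only [Nat.choose_one_right] at h1 h2
    lia

variable {ι V W : Type*}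

/-- `W` consists of copies of `V`, embedded by `i k`, where the corner `l` of the copy `k` is
identified with the corner `k` of the copy `l` and there are no other identifications. -/
structure IsGluing (c : ι → V) (i : ι → V → W) : Prop where
  corner_injective : Function.Injective c
  injective : ∀ k, Function.Injective (i k)
  comm : ∀ k l, i k (c l) = i l (c k)
  overlap : ∀ {k l u v}, k ≠ l → i k u = i l v → u = c l ∧ v = c k
  cover : ∀ w, ∃ k u, i k u = w

/-- The union of graphs on the copies. -/
def glue (i : ι → V → W) (t : ι → SimpleGraph V) : SimpleGraph W :=
  ⨆ k, (t k).map (i k)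

/-- The outer corners: the corner `k` of the copy `k`, for each `k`. -/
def outer (c : ι → V) (i : ι → V → W) (k : ι) : W := i k (c k)

namespace IsGluing

variable {c : ι → V} {i : ι → V → W} {t : ι → SimpleGraph V}

/-- The point of `W` at which the corner `l` of the copy `k` is identified with the corner `k` of
the copy `l`. -/
def point (h : IsGluing c i) : Sym2 ι → W :=
  Sym2.lift ⟨fun k l => i k (c l), h.comm⟩

theorem point_mk (h : IsGluing c i) (k l : ι) : h.point s(k, l) = i k (c l) := rfl

theorem point_injective (h : IsGluing c i) : Function.Injective h.point := by
  intro x y hxy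
  induction x with | _ k l
  induction y with | _ k' l'
  rw [point_mk, point_mk] at hxy
  rcases eq_or_ne k k' with rfl | hk
  · rw [h.corner_injective (h.injective k hxy)]
  · obtain ⟨hl, hl'⟩ := h.overlap hk hxy
    rw [h.corner_injective hl, h.corner_injective hl', Sym2.eq_swap]

/-- A vertex of `W` is a point, or belongs to a single copy. -/
theorem card_add_choose [Finite V] [Fintype ι] (h : IsGluing c i) :
    Nat.card W + (Fintype.card ι).choose 2 = Fintype.card ι * Nat.card V := by
  let f : ι × ↥(Set.range c)ᶜ ⊕ Sym2 ι → W := Sum.elim (fun x => i x.1 x.2) h.point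
  have hf : Function.Bijective f := by
    constructor
    · refine Function.Injective.sumElim ?_ h.point_injective ?_
      · rintro ⟨k, v, hv⟩ ⟨l, u, hu⟩ (hw : i k v = i l u)
        rcases eq_or_ne k l with rfl | hkl
        · obtain rfl := h.injective k hw
          rfl
        · exact absurd ⟨l, (h.overlap hkl hw).1.symm⟩ hv
      · rintro ⟨k, v, hv⟩ x (hw : i k v = h.point x)
        induction x with | _ l l'
        rcases eq_or_ne k l with rfl | hkl
        · exact hv ⟨l', (h.injective k hw).symm⟩
        · exact hv ⟨l, (h.overlap hkl hw).1.symm⟩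
    · intro w
      obtain ⟨k, v, rfl⟩ := h.cover w
      by_cases hv : v ∈ Set.range c
      · obtain ⟨l, rfl⟩ := hv
        exact ⟨.inr s(k, l), rfl⟩
      · exact ⟨.inl (k, ⟨v, hv⟩), rfl⟩
  have hV : Nat.card ↥(Set.range c)ᶜ + Fintype.card ι = Nat.card V := by
    rw [← Set.ncard_add_ncard_compl (Set.range c), Nat.card_coe_set_eq, add_comm,
      ← Set.image_univ, Set.ncard_image_of_injective _ h.corner_injective, Set.ncard_univ,
      Nat.card_eq_fintype_card]
  rw [← Nat.card_congr (Equiv.ofBijective f hf), Nat.card_sum, Nat.card_prod, ← hV, mul_add,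
    ← choose_two_add_choose_succ_two, Nat.card_eq_fintype_card (α := ι),
    Nat.card_eq_fintype_card (α := Sym2 ι), Sym2.card]
  ring

theorem glue_adj (h : IsGluing c i) {x y : W} :
    (glue i t).Adj x y ↔ ∃ k u v, (t k).Adj u v ∧ i k u = x ∧ i k v = y := by
  simp only [glue, SimpleGraph.iSup_adj, SimpleGraph.map_adj']
  constructor
  · rintro ⟨k, -, u, v, huv⟩
    exact ⟨k, u, v, huv⟩
  · rintro ⟨k, u, v, huv, rfl, rfl⟩
    exact ⟨k, (h.injective k).ne huv.ne, u, v, huv, rfl, rfl⟩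

theorem eq_of_eq_of_eq (h : IsGluing c i) {k l : ι} {u v u' v' : V} (huv : u ≠ v)
    (hu : i k u = i l u') (hv : i k v = i l v') : k = l := by
  by_contra hkl
  exact huv ((h.overlap hkl hu).1.trans (h.overlap hkl hv).1.symm)

theorem glue_adj_apply (h : IsGluing c i) {k : ι} {u v : V} :
    (glue i t).Adj (i k u) (i k v) ↔ (t k).Adj u v := by
  rw [h.glue_adj]
  constructor
  · rintro ⟨l, u', v', huv, hu, hv⟩
    obtain rfl := h.eq_of_eq_of_eq huv.ne hu hv
    rwa [← h.injective _ hu, ← h.injective _ hv]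
  · exact fun huv => ⟨k, u, v, huv, rfl, rfl⟩

theorem comap_glue (h : IsGluing c i) (k : ι) : (glue i t).comap (i k) = t k := by
  ext u v
  exact h.glue_adj_apply

theorem glue_injective (h : IsGluing c i) : Function.Injective (glue i) := by
  intro t t' htt
  funext k
  rw [← h.comap_glue (t := t) k, htt, h.comap_glue]

theorem glue_le_glue_iff (h : IsGluing c i) {t' : ι → SimpleGraph V} :
    glue i t ≤ glue i t' ↔ ∀ k, t k ≤ t' k :=
  ⟨fun ht _ _ _ huv => h.glue_adj_apply.1 (ht (h.glue_adj_apply.2 huv)),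
    fun ht => iSup_mono fun k => SimpleGraph.map_monotone _ (ht k)⟩

theorem exists_eq_glue (h : IsGluing c i) {T : SimpleGraph W} (hT : T ≤ glue i t) :
    ∃ t' : ι → SimpleGraph V, T = glue i t' := by
  refine ⟨fun k => T.comap (i k), ?_⟩
  ext x y
  rw [h.glue_adj]
  constructor
  · intro hxy
    obtain ⟨k, u, v, -, rfl, rfl⟩ := h.glue_adj.1 (hT hxy)
    exact ⟨k, u, v, hxy, rfl, rfl⟩
  · rintro ⟨k, u, v, huv, rfl, rfl⟩
    exact huv

theorem neighborSet_outer (h : IsGluing c i) (k : ι) :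
    (glue i t).neighborSet (outer c i k) = i k '' (t k).neighborSet (c k) := by
  ext y
  simp only [SimpleGraph.mem_neighborSet, Set.mem_image, outer]
  constructor
  · intro hy
    obtain ⟨l, u, v, huv, hu, rfl⟩ := h.glue_adj.1 hy
    rcases eq_or_ne l k with rfl | hlk
    · exact ⟨v, h.injective _ hu ▸ huv, rfl⟩
    · exact absurd (h.corner_injective (h.overlap hlk hu).2).symm hlk
  · rintro ⟨v, hv, rfl⟩
    exact h.glue_adj_apply.2 hv

theorem ncard_edgeSet_glue [Finite V] [Fintype ι] (h : IsGluing c i) :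
    (glue i t).edgeSet.ncard = ∑ k, (t k).edgeSet.ncard := by
  have hunion : (glue i t).edgeSet = ⋃ k, Sym2.map (i k) '' (t k).edgeSet := by
    ext e
    induction e with | _ x y
    simp only [SimpleGraph.mem_edgeSet, h.glue_adj, Set.mem_iUnion, Set.mem_image]
    refine exists_congr fun k => ⟨?_, ?_⟩
    · rintro ⟨u, v, huv, rfl, rfl⟩
      exact ⟨s(u, v), huv, rfl⟩
    · rintro ⟨e, he, hexy⟩
      induction e with | _ u v
      obtain ⟨rfl, rfl⟩ | ⟨rfl, rfl⟩ := Sym2.eq_iff.1 hexy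
      exacts [⟨u, v, he, rfl, rfl⟩, ⟨v, u, he.symm, rfl, rfl⟩]
  have hdisj : Pairwise (Function.onFun Disjoint fun k => Sym2.map (i k) '' (t k).edgeSet) := by
    refine fun k l hkl => Set.disjoint_left.2 ?_
    rintro _ ⟨e, he, rfl⟩ ⟨e', -, hee⟩
    induction e with | _ u v
    induction e' with | _ u' v'
    obtain ⟨hu, hv⟩ | ⟨hv, hu⟩ := Sym2.eq_iff.1 hee <;>
      exact hkl (h.eq_of_eq_of_eq he.ne hu.symm hv.symm)
  rw [hunion, Set.ncard_iUnion_of_finite (fun k => (Set.toFinite _).image _) hdisj,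
    finsum_eq_sum_of_fintype]
  exact Finset.sum_congr rfl fun k _ =>
    Set.ncard_image_of_injective _ (Sym2.map.injective (h.injective k))

theorem reachable_glue (h : IsGluing c i) {k : ι} {u v : V} (huv : (t k).Reachable u v) :
    (glue i t).Reachable (i k u) (i k v) :=
  huv.map (⟨i k, h.glue_adj_apply.2⟩ : t k →g glue i t)

/-- A path of the glued graph changes copies only at points. -/
theorem exists_amalgam_of_reachable (h : IsGluing c i) {x : Sym2 ι} {w : W}
    (hw : (glue i t).Reachable (h.point x) w) {k : ι} {u : V} (hu : i k u = w) :
    ∃ l, amalgam (fun k => cornerPartition (t k) c) x s(k, l) ∧ (t k).Reachable (c l) u := by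
  have change_copy {k k' l : ι} {u u' : V} (huu : i k u = i k' u')
      (hx : amalgam (fun k => cornerPartition (t k) c) x s(k', l))
      (hl : (t k').Reachable (c l) u') :
      ∃ l, amalgam (fun k => cornerPartition (t k) c) x s(k, l) ∧ (t k).Reachable (c l) u := by
    rcases eq_or_ne k k' with rfl | hk
    · exact ⟨l, hx, h.injective k huu ▸ hl⟩
    · obtain ⟨rfl, rfl⟩ := h.overlap hk huu
      refine ⟨k', ?_, .refl _⟩
      rw [Sym2.eq_swap]
      exact Setoid.trans' _ hx (amalgam_of_rel hl)
  rw [SimpleGraph.reachable_iff_reflTransGen] at hw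
  induction hw generalizing k u with
  | refl =>
    induction x with | _ k₀ l₀
    exact change_copy hu (Setoid.refl' _ _) (.refl _)
  | tail _ hadj ih =>
    obtain ⟨k', v, v', hv, rfl, rfl⟩ := h.glue_adj.1 hadj
    obtain ⟨l, hx, hl⟩ := ih rfl
    exact change_copy hu hx (hl.trans hv.reachable)

theorem reachable_point_iff (h : IsGluing c i) {x y : Sym2 ι} :
    (glue i t).Reachable (h.point x) (h.point y) ↔
      amalgam (fun k => cornerPartition (t k) c) x y := by
  constructor
  · intro hxy
    induction y with | _ k l
    obtain ⟨l', hx, hl⟩ := h.exists_amalgam_of_reachable hxy rfl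
    exact Setoid.trans' _ hx (amalgam_of_rel hl)
  · have hle : amalgam (fun k => cornerPartition (t k) c) ≤
        (glue i t).reachableSetoid.comap h.point :=
      amalgam_le_iff.2 fun k l l' hl => h.reachable_glue hl
    exact fun hxy => hle hxy

theorem cornerPartition_glue (h : IsGluing c i) :
    cornerPartition (glue i t) (outer c i) =
      (amalgam fun k => cornerPartition (t k) c).comap Sym2.diag :=
  Setoid.ext fun k l => h.reachable_point_iff (x := .diag k) (y := .diag l)

theorem forall_exists_reachable_outer_iff (h : IsGluing c i) :
    (∀ w, ∃ k, (glue i t).Reachable (outer c i k) w) ↔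
      (∀ k v, ∃ l, (t k).Reachable (c l) v) ∧
        ∀ x, ∃ k, amalgam (fun k => cornerPartition (t k) c) (Sym2.diag k) x := by
  constructor
  · refine fun hT => ⟨fun k v => ?_, fun x => ?_⟩
    · obtain ⟨j, hj⟩ := hT (i k v)
      obtain ⟨l, -, hl⟩ := h.exists_amalgam_of_reachable (x := Sym2.diag j) hj rfl
      exact ⟨l, hl⟩
    · obtain ⟨k, hk⟩ := hT (h.point x)
      exact ⟨k, h.reachable_point_iff.1 hk⟩
  · rintro ⟨ht, hx⟩ w
    obtain ⟨k, v, rfl⟩ := h.cover w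
    obtain ⟨l, hl⟩ := ht k v
    obtain ⟨j, hj⟩ := hx s(k, l)
    exact ⟨j, (h.reachable_point_iff.2 hj).trans (h.reachable_glue hl)⟩

theorem isCornerForest_glue_iff [Finite V] [Fintype ι] (h : IsGluing c i) {q : Setoid ι} :
    IsCornerForest (glue i t) (outer c i) ∧ cornerPartition (glue i t) (outer c i) = q ↔
      (∀ k, IsCornerForest (t k) c) ∧ Glues (fun k => cornerPartition (t k) c) q := by
  have : Finite W := .of_surjective (fun x : ι × V => i x.1 x.2) fun w => by
    obtain ⟨k, u, hu⟩ := h.cover w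
    exact ⟨(k, u), hu⟩
  have hW := h.card_add_choose
  have hE := h.ncard_edgeSet_glue (t := t)
  constructor
  · rintro ⟨⟨hacyclic, hreach⟩, rfl⟩
    obtain ⟨ht, hx⟩ := h.forall_exists_reachable_outer_iff.1 hreach
    have hforest (k) : IsCornerForest (t k) c :=
      ⟨h.comap_glue (t := t) k ▸ hacyclic.comap ⟨i k, id⟩ (h.injective k), ht k⟩
    refine ⟨hforest, h.cornerPartition_glue.symm, hx, ?_⟩
    have hV := Finset.sum_congr rfl fun k (_ : k ∈ Finset.univ) =>
      (isAcyclic_iff_card_quotient_cornerPartition (ht k)).1 (hforest k).isAcyclic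
    rw [Finset.sum_add_distrib, ← hE, Finset.sum_const, Finset.card_univ, smul_eq_mul] at hV
    have hglue := (isAcyclic_iff_card_quotient_cornerPartition hreach).1 hacyclic
    lia
  · rintro ⟨hforest, rfl, hx, hcard⟩
    have hreach := h.forall_exists_reachable_outer_iff.2
      ⟨fun k => (hforest k).exists_reachable, hx⟩
    refine ⟨⟨(isAcyclic_iff_card_quotient_cornerPartition hreach).2 ?_, hreach⟩,
      h.cornerPartition_glue⟩
    have hV := Finset.sum_congr rfl fun k (_ : k ∈ Finset.univ) =>
      (isAcyclic_iff_card_quotient_cornerPartition (hforest k).exists_reachable).1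
        (hforest k).isAcyclic
    rw [Finset.sum_add_distrib, ← hE, Finset.sum_const, Finset.card_univ, smul_eq_mul] at hV
    rw [h.cornerPartition_glue]
    lia

theorem ncard_cornerForests_glue [Finite V] [Fintype ι] (h : IsGluing c i) {q : Setoid ι}
    {S : Finset (ι → Setoid ι)} (hS : ∀ p, p ∈ S ↔ Glues p q) {G : ι → SimpleGraph V}
    {P : ι → Set (SimpleGraph V)} {Q : Set (SimpleGraph W)}
    (hPQ : ∀ t, glue i t ∈ Q ↔ ∀ k, t k ∈ P k) :
    (cornerForests (glue i G) (outer c i) q ∩ Q).ncard =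
      ∑ p ∈ S, ∏ k, (cornerForests (G k) c (p k) ∩ P k).ncard := by
  let A (p : ι → Setoid ι) : Set (ι → SimpleGraph V) :=
    Set.univ.pi fun k => cornerForests (G k) c (p k) ∩ P k
  have hunion : cornerForests (glue i G) (outer c i) q ∩ Q = ⋃ p : S, glue i '' A p := by
    ext T
    simp only [Set.mem_iUnion]
    constructor
    · rintro ⟨⟨hT, hforest⟩, hQ⟩
      obtain ⟨t, rfl⟩ := h.exists_eq_glue hT
      obtain ⟨ht, hglues⟩ := h.isCornerForest_glue_iff.1 hforest
      exact ⟨⟨_, (hS _).2 hglues⟩, t, fun k _ =>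
        ⟨⟨h.glue_le_glue_iff.1 hT k, ht k, rfl⟩, hPQ t |>.1 hQ k⟩, rfl⟩
    · rintro ⟨⟨p, hp⟩, t, ht, rfl⟩
      obtain rfl : (fun k => cornerPartition (t k) c) = p := funext fun k => (ht k trivial).1.2.2
      exact ⟨⟨h.glue_le_glue_iff.2 fun k => (ht k trivial).1.1,
        h.isCornerForest_glue_iff.2 ⟨fun k => (ht k trivial).1.2.1, (hS _).1 hp⟩⟩,
        (hPQ t).2 fun k => (ht k trivial).2⟩
  have hdisj : Pairwise (Function.onFun Disjoint fun p : S => glue i '' A p) := by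
    refine fun p p' hp => Set.disjoint_image_of_injective h.glue_injective ?_
    refine Set.disjoint_left.2 fun t ht ht' => hp (Subtype.ext (funext fun k => ?_))
    exact (ht k trivial).1.2.2.symm.trans (ht' k trivial).1.2.2
  have hcard (p : S) : (glue i '' A p).ncard =
      ∏ k, (cornerForests (G k) c (p.1 k) ∩ P k).ncard := by
    rw [Set.ncard_image_of_injective _ h.glue_injective, ← Nat.card_coe_set_eq,
      Nat.card_congr (Equiv.Set.univPi _), Nat.card_pi]
    rfl
  rw [hunion, Set.ncard_iUnion_of_finite (fun k => (Set.toFinite _).image _) hdisj,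
    finsum_eq_sum_of_fintype]
  simp only [hcard]
  exact Finset.sum_coe_sort S fun p => ∏ k, (cornerForests (G k) c (p k) ∩ P k).ncard

end IsGluing

end Gluing

/-- The partitions of three corners: `sep k` separates the corner `k` from the other two. -/
inductive Pattern
  | full
  | sep (k : Fin 3)
  | discrete
  deriving DecidableEq, Fintype

namespace Pattern

/-- Pairs of corners that generate the partition. -/
def edges : Pattern → List (Fin 3 × Fin 3)
  | full => [(0, 1), (1, 2)]
  | sep k => [(k + 1, k + 2)]
  | discrete => []

/-- A labelling of the corners by the classes of the partition. -/
def label (p : Pattern) : Fin 3 → Fin 3 := p.edges.foldl merge id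

/-- The partition described by a pattern. -/
def setoid (p : Pattern) : Setoid (Fin 3) := Setoid.ker p.label

/-- The number of classes of the partition. -/
def size (p : Pattern) : ℕ := (Finset.univ.image p.label).card

theorem card_quotient_setoid (p : Pattern) : Nat.card (Quotient p.setoid) = p.size := by
  rw [setoid, Nat.card_congr (Setoid.quotientKerEquivRange _), size, Nat.card_coe_set_eq,
    ← Set.image_univ, ← Finset.coe_univ, ← Finset.coe_image, Set.ncard_coe_finset]

theorem setoid_le_iff {p : Pattern} {r : Setoid (Fin 3)} :
    p.setoid ≤ r ↔ ∀ e ∈ p.edges, r e.1 e.2 := by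
  rw [setoid, label, ker_foldl_merge_le_iff]
  exact and_iff_right fun k l (hkl : k = l) => hkl ▸ r.refl k

theorem setoid_injective : Function.Injective setoid := by
  have hlabel : ∀ p q : Pattern,
      (∀ k l, p.label k = p.label l ↔ q.label k = q.label l) → p = q := by
    decide
  exact fun p q hpq => hlabel p q fun k l => Setoid.ext_iff.1 hpq k l

theorem setoid_surjective : Function.Surjective setoid := by
  classical
  have hlabel : ∀ R : Fin 3 → Fin 3 → Bool, (∀ k, R k k) → (∀ k l, R k l → R l k) →
      (∀ k l m, R k l → R l m → R k m) → ∃ p : Pattern, ∀ k l, p.label k = p.label l ↔ R k l := by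
    decide +kernel
  intro r
  obtain ⟨p, hp⟩ := hlabel (fun k l => decide (r k l)) (by simp)
    (by simpa using fun _ _ => r.symm') (by simpa using fun _ _ _ => r.trans')
  exact ⟨p, Setoid.ext fun k l => (hp k l).trans decide_eq_true_iff⟩

theorem setoid_full : full.setoid = ⊤ := by
  have hlabel : ∀ k l, full.label k = full.label l := by decide
  exact Setoid.eq_top_iff.2 hlabel

theorem eq_setoid_sep_iff {r : Setoid (Fin 3)} {k : Fin 3} :
    r = (sep k).setoid ↔ r (k + 1) (k + 2) ∧ ¬ r (k + 1) k := by
  have hlabel : ∀ p k, p = sep k ↔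
      p.label (k + 1) = p.label (k + 2) ∧ ¬ p.label (k + 1) = p.label k := by
    decide
  obtain ⟨p, rfl⟩ := setoid_surjective r
  exact setoid_injective.eq_iff.trans (hlabel p k)

/-- The pairs of points of the glued triangle identified by patterns of its three copies. -/
def gluedEdges (x : Fin 3 → Pattern) : List (Sym2 (Fin 3) × Sym2 (Fin 3)) :=
  (List.finRange 3).flatMap fun k => (x k).edges.map fun e => (s(k, e.1), s(k, e.2))

/-- A labelling of the points of the glued triangle by their clusters. -/
def gluedLabel (x : Fin 3 → Pattern) : Sym2 (Fin 3) → Sym2 (Fin 3) :=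
  (gluedEdges x).foldl merge id

theorem amalgam_setoid (x : Fin 3 → Pattern) :
    amalgam (fun k => (x k).setoid) = Setoid.ker (gluedLabel x) := by
  refine eq_of_forall_ge_iff fun r => ?_
  have hbot : Setoid.ker (id : Sym2 (Fin 3) → _) ≤ r := fun y z (hyz : y = z) => hyz ▸ r.refl y
  have hedges (k) : (∀ l l', (x k).setoid l l' → r s(k, l) s(k, l')) ↔
      ∀ e ∈ (x k).edges, r s(k, e.1) s(k, e.2) :=
    setoid_le_iff (r := r.comap fun l => s(k, l))
  simp only [amalgam_le_iff, hedges, gluedLabel, ker_foldl_merge_le_iff, hbot, gluedEdges,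
    List.forall_mem_flatMap, List.mem_finRange, List.forall_mem_map, true_and, true_imp_iff]

/-- The triples of patterns of the three copies that glue to a forest with pattern `q`. -/
def gluings (q : Pattern) : Finset (Fin 3 → Pattern) :=
  Finset.univ.filter fun x => ∑ k, (x k).size = 3 + q.size ∧
    (∀ k l, gluedLabel x (.diag k) = gluedLabel x (.diag l) ↔ q.label k = q.label l) ∧
    ∀ y, ∃ k, gluedLabel x (.diag k) = gluedLabel x y

theorem mem_gluings_iff {q : Pattern} {x : Fin 3 → Pattern} :
    x ∈ gluings q ↔ Glues (fun k => (x k).setoid) q.setoid := by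
  have hcard : ∑ k, (x k).size = 3 + q.size ↔ ∑ k, Nat.card (Quotient (x k).setoid) =
      (Fintype.card (Fin 3)).choose 2 + Nat.card (Quotient q.setoid) := by
    simp only [card_quotient_setoid, Fintype.card_fin, show Nat.choose 3 2 = 3 from rfl]
  have hdiag : (∀ k l, gluedLabel x (.diag k) = gluedLabel x (.diag l) ↔ q.label k = q.label l) ↔
      (amalgam fun k => (x k).setoid).comap Sym2.diag = q.setoid := by
    rw [amalgam_setoid, Setoid.ext_iff]
    rfl
  have hpoint : (∀ y, ∃ k, gluedLabel x (.diag k) = gluedLabel x y) ↔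
      ∀ y, ∃ k, amalgam (fun k => (x k).setoid) (.diag k) y := by
    rw [amalgam_setoid]
    rfl
  rw [gluings, Finset.mem_filter_univ, hcard, hdiag, hpoint]
  exact ⟨fun ⟨hcard, hdiag, hpoint⟩ => ⟨hdiag, hpoint, hcard⟩,
    fun ⟨hdiag, hpoint, hcard⟩ => ⟨hcard, hdiag, hpoint⟩⟩

theorem val_gluings_full : (gluings full).val = {
    ![full, full, sep 0], ![full, full, sep 1], ![full, sep 0, full], ![full, sep 2, full],
    ![sep 1, full, full], ![sep 2, full, full]} := by
  decide +kernel

theorem val_gluings_sep_one : (gluings (sep 1)).val = {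
    ![full, sep 0, sep 1], ![full, sep 1, sep 0], ![full, sep 1, sep 1], ![full, discrete, full],
    ![sep 1, full, sep 1], ![sep 1, sep 1, full], ![sep 1, sep 2, full],
    ![sep 2, sep 1, full]} := by
  decide +kernel

theorem val_gluings_sep_two : (gluings (sep 2)).val = {
    ![full, full, discrete], ![full, sep 0, sep 2], ![full, sep 2, sep 0], ![full, sep 2, sep 2],
    ![sep 1, full, sep 2], ![sep 2, full, sep 1], ![sep 2, full, sep 2],
    ![sep 2, sep 2, full]} := by
  decide +kernel

theorem val_gluings_sep_zero : (gluings (sep 0)).val = {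
    ![full, sep 0, sep 0], ![sep 0, full, sep 0], ![sep 0, full, sep 1], ![sep 0, sep 0, full],
    ![sep 0, sep 2, full], ![sep 1, full, sep 0], ![sep 2, sep 0, full],
    ![discrete, full, full]} := by
  decide +kernel

theorem map_size_gluings_discrete : (gluings discrete).val.map (fun x k => (x k).size) =
    14 • {![2, 2, 2]} + 2 • {![1, 2, 3], ![1, 3, 2], ![2, 1, 3], ![2, 3, 1], ![3, 1, 2],
      ![3, 2, 1]} := by
  decide +kernel

end Pattern

/-- The corners of `SG(n)`. -/
def corner (n : ℕ) : Fin 3 → Vert n := ![o n, a n, b n]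

/-- The number of spanning forests of `SG(n)` that connect the corners according to the pattern `p`,
with each tree containing a corner, and whose number of bonds at `o` belongs to `D`. -/
noncomputable def count (D : Set ℕ) (n : ℕ) (p : Pattern) : ℕ :=
  (cornerForests (SG n) (corner n) p.setoid ∩ {T | bonds T (o n) ∈ D}).ncard

section Triangle

variable {V : Type*}

/-- The graph with a prescribed finite set of edges, where loops are discarded. -/
def edgeGraph (E : Finset (Sym2 V)) : SimpleGraph V := .fromEdgeSet E

instance [DecidableEq V] (E : Finset (Sym2 V)) : DecidableRel (edgeGraph E).Adj := fun u v =>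
  decidable_of_iff (s(u, v) ∈ E ∧ u ≠ v) (by simp [edgeGraph])

theorem edgeSet_edgeGraph {G : SimpleGraph V} {E : Finset (Sym2 V)} (hE : ↑E ⊆ G.edgeSet) :
    (edgeGraph E).edgeSet = E := by
  rw [edgeGraph, SimpleGraph.edgeSet_fromEdgeSet, sdiff_eq_left]
  exact Set.disjoint_left.2 fun e he hdiag => G.not_isDiag_of_mem_edgeSet (hE he) hdiag

theorem edgeGraph_edgeFinset (T : SimpleGraph V) [Fintype T.edgeSet] :
    edgeGraph T.edgeFinset = T := by
  rw [edgeGraph, SimpleGraph.coe_edgeFinset, SimpleGraph.fromEdgeSet_edgeSet]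

theorem SG_zero : SG 0 = ⊤ := by
  ext ⟨x, hx⟩ ⟨y, hy⟩
  rw [SimpleGraph.top_adj, ne_eq, Subtype.mk.injEq]
  exact ⟨And.left, fun h => ⟨h, .inl ⟨hx, hy⟩⟩⟩

theorem corner_zero_surjective : Function.Surjective (corner 0) := by
  decide

/-- The edge sets of the forests of the triangle `SG(0)` that connect the corners according to the
pattern `p`, in a decidable form. -/
def triangleForests (p : Pattern) : Finset (Finset (Sym2 (Vert 0))) :=
  (⊤ : SimpleGraph (Vert 0)).edgeFinset.powerset.filter fun E => E.card + p.size = 3 ∧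
    ∀ k l, (edgeGraph E).Reachable (corner 0 k) (corner 0 l) ↔ p.label k = p.label l

/-- The degrees of `o` in the forests of the triangle with pattern `p`. -/
def triangleDegrees (p : Pattern) : Multiset ℕ :=
  (triangleForests p).val.map fun E => (edgeGraph E).degree (o 0)

theorem mem_triangleForests_iff {p : Pattern} {E : Finset (Sym2 (Vert 0))} :
    E ∈ triangleForests p ↔
      ↑E ⊆ (SG 0).edgeSet ∧ edgeGraph E ∈ cornerForests (SG 0) (corner 0) p.setoid := by
  have hcard : Nat.card (Vert 0) = 3 := by
    rw [Nat.card_eq_fintype_card]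
    decide
  rw [triangleForests, Finset.mem_filter, Finset.mem_powerset, ← Finset.coe_subset,
    SimpleGraph.coe_edgeFinset, mem_cornerForests_of_surjective corner_zero_surjective, SG_zero]
  refine and_congr_right fun hE => ?_
  rw [and_iff_right le_top, edgeSet_edgeGraph hE, Set.ncard_coe_finset,
    Pattern.card_quotient_setoid, hcard, Setoid.ext_iff]
  rfl

theorem count_zero (D : Set ℕ) [DecidablePred (· ∈ D)] (p : Pattern) :
    count D 0 p = (triangleDegrees p).countP (· ∈ D) := by
  classical
  have hbonds (E : Finset (Sym2 (Vert 0))) :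
      bonds (edgeGraph E) (o 0) = (edgeGraph E).degree (o 0) :=
    Set.ncard_eq_toFinset_card' _
  have himage : cornerForests (SG 0) (corner 0) p.setoid ∩ {T | bonds T (o 0) ∈ D} =
      edgeGraph '' ((triangleForests p).filter fun E => (edgeGraph E).degree (o 0) ∈ D) := by
    ext T
    simp only [Set.mem_image, Finset.mem_coe, Finset.mem_filter, mem_triangleForests_iff, ← hbonds]
    constructor
    · intro hT
      refine ⟨T.edgeFinset, ?_, edgeGraph_edgeFinset T⟩
      rw [edgeGraph_edgeFinset, SimpleGraph.coe_edgeFinset]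
      exact ⟨⟨SimpleGraph.edgeSet_mono hT.1.1, hT.1⟩, hT.2⟩
    · rintro ⟨E, ⟨⟨-, hE⟩, hD⟩, rfl⟩
      exact ⟨hE, hD⟩
  have hinj : Set.InjOn edgeGraph (triangleForests p : Set (Finset (Sym2 (Vert 0)))) := by
    intro E hE E' hE' h
    rw [← Finset.coe_inj, ← edgeSet_edgeGraph (mem_triangleForests_iff.1 hE).1, h,
      edgeSet_edgeGraph (mem_triangleForests_iff.1 hE').1]
  rw [count, himage, (hinj.mono (Finset.coe_subset.2 (Finset.filter_subset _ _))).ncard_image,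
    Set.ncard_coe_finset, triangleDegrees, Multiset.countP_map]
  rfl

open Pattern

theorem triangleDegrees_full : triangleDegrees full = {1, 1, 2} := by
  decide +kernel

theorem triangleDegrees_sep_two : triangleDegrees (sep 2) = {1} := by
  decide +kernel

theorem triangleDegrees_discrete : triangleDegrees discrete = {0} := by
  decide +kernel

end Triangle

section Copies

theorem coe_corner (n : ℕ) (k : Fin 3) :
    (corner n k : ℕ × ℕ) = (if k = 1 then 2 ^ n else 0, if k = 2 then 2 ^ n else 0) := by
  fin_cases k <;> rfl

/-- The translation that takes the leftmost vertex of `SG(n)` to the corner `k`. -/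
def shift (n : ℕ) (k : Fin 3) (p : ℕ × ℕ) : ℕ × ℕ := p + corner n k

theorem shift_injective (n : ℕ) (k : Fin 3) : Function.Injective (shift n k) :=
  add_left_injective _

theorem mem_verts_succ {n : ℕ} {w : ℕ × ℕ} :
    w ∈ verts (n + 1) ↔ ∃ k, ∃ p ∈ verts n, shift n k p = w := by
  have hzero : w ∈ verts n ↔ ∃ p ∈ verts n, shift n 0 p = w :=
    (exists_eq_right (p := (· ∈ verts n))).symm
  rw [Fin.exists_fin_succ, Fin.exists_fin_two, ← hzero, verts, Finset.mem_union, Finset.mem_union,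
    Finset.mem_image, Finset.mem_image, or_assoc]
  rfl

theorem latticeGraph_succ_adj {n : ℕ} {x y : ℕ × ℕ} : (latticeGraph (n + 1)).Adj x y ↔
    ∃ k u v, (latticeGraph n).Adj u v ∧ shift n k u = x ∧ shift n k v = y := by
  have hmap (k : Fin 3) : (∃ u v, (latticeGraph n).Adj u v ∧ shift n k u = x ∧ shift n k v = y) ↔
      ((latticeGraph n).map (shift n k)).Adj x y :=
    (SimpleGraph.map_adj ⟨shift n k, shift_injective n k⟩ _ _ _).symm
  have hzero : (latticeGraph n).map (shift n 0) = latticeGraph n := SimpleGraph.map_id _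
  simp only [hmap]
  rw [Fin.exists_fin_succ, Fin.exists_fin_two, hzero, ← or_assoc]
  rfl

theorem add_le_of_mem_verts {n : ℕ} {p : ℕ × ℕ} (hp : p ∈ verts n) : p.1 + p.2 ≤ 2 ^ n := by
  induction n generalizing p with
  | zero =>
    revert p
    decide
  | succ n ih =>
    obtain ⟨k, u, hu, rfl⟩ := mem_verts_succ.1 hp
    have hu' := ih hu
    have hk := ih (corner n k).2
    simp only [shift, Prod.fst_add, Prod.snd_add, pow_succ]
    lia

theorem mem_verts_of_adj {n : ℕ} {x y : ℕ × ℕ} (hxy : (latticeGraph n).Adj x y) :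
    x ∈ verts n := by
  induction n generalizing x y with
  | zero => exact hxy.2.elim And.left And.right
  | succ n ih =>
    obtain ⟨k, u, v, huv, rfl, -⟩ := latticeGraph_succ_adj.1 hxy
    exact mem_verts_succ.2 ⟨k, u, ih huv, rfl⟩

/-- The inclusion of the copy of `SG(n)` with leftmost vertex `corner n k` into `SG(n + 1)`. -/
def copy (n : ℕ) (k : Fin 3) (v : Vert n) : Vert (n + 1) :=
  ⟨shift n k v.1, mem_verts_succ.2 ⟨k, v.1, v.2, rfl⟩⟩

theorem isGluing_copy (n : ℕ) : IsGluing (corner n) (copy n) where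
  corner_injective := by
    intro k l h
    replace h := congrArg Subtype.val h
    have hpos := Nat.two_pow_pos n
    grind [coe_corner]
  injective k u v h := Subtype.ext (shift_injective n k (congrArg Subtype.val h))
  comm k l := Subtype.ext (add_comm _ _)
  overlap := by
    rintro k l ⟨⟨x, y⟩, hu⟩ ⟨⟨x', y'⟩, hv⟩ hkl h
    have hu' := add_le_of_mem_verts hu
    have hv' := add_le_of_mem_verts hv
    replace h : (x, y) + (corner n k : ℕ × ℕ) = (x', y') + corner n l := congrArg Subtype.val h
    simp only [coe_corner, Prod.mk_add_mk, Prod.mk.injEq] at h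
    simp only [Subtype.ext_iff, coe_corner, Prod.mk.injEq]
    grind
  cover := by
    rintro ⟨w, hw⟩
    obtain ⟨k, p, hp, rfl⟩ := mem_verts_succ.1 hw
    exact ⟨k, ⟨p, hp⟩, rfl⟩

theorem outer_copy (n : ℕ) : outer (corner n) (copy n) = corner (n + 1) := by
  funext k
  apply Subtype.ext
  change (corner n k : ℕ × ℕ) + corner n k = corner (n + 1) k
  simp only [coe_corner, Prod.mk_add_mk, Prod.mk.injEq]
  grind

theorem SG_succ (n : ℕ) : SG (n + 1) = glue (copy n) fun _ => SG n := by
  ext x y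
  rw [(isGluing_copy n).glue_adj, SG, SimpleGraph.comap_adj, latticeGraph_succ_adj]
  constructor
  · rintro ⟨k, u, v, huv, hu, hv⟩
    exact ⟨k, ⟨u, mem_verts_of_adj huv⟩, ⟨v, mem_verts_of_adj huv.symm⟩, huv, Subtype.ext hu,
      Subtype.ext hv⟩
  · rintro ⟨k, u, v, huv, rfl, rfl⟩
    exact ⟨k, u, v, huv, rfl, rfl⟩

end Copies

section Recursion

theorem bonds_glue (n : ℕ) (t : Fin 3 → SimpleGraph (Vert n)) :
    bonds (glue (copy n) t) (o (n + 1)) = bonds (t 0) (o n) := by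
  have ho : o (n + 1) = outer (corner n) (copy n) 0 := (congrFun (outer_copy n) 0).symm
  rw [bonds, ho, (isGluing_copy n).neighborSet_outer,
    Set.ncard_image_of_injective _ ((isGluing_copy n).injective 0)]
  rfl

theorem count_succ (D : Set ℕ) (n : ℕ) (q : Pattern) :
    count D (n + 1) q =
      ∑ x ∈ q.gluings, count D n (x 0) * count .univ n (x 1) * count .univ n (x 2) := by
  let setoids : (Fin 3 → Pattern) ↪ (Fin 3 → Setoid (Fin 3)) :=
    ⟨fun x k => (x k).setoid, Pattern.setoid_injective.comp_left⟩
  have hS (p : Fin 3 → Setoid (Fin 3)) : p ∈ q.gluings.map setoids ↔ Glues p q.setoid := by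
    obtain ⟨x, rfl⟩ : ∃ x, setoids x = p := Pattern.setoid_surjective.comp_left p
    rw [Finset.mem_map' setoids]
    exact Pattern.mem_gluings_iff
  have hPQ (t : Fin 3 → SimpleGraph (Vert n)) :
      glue (copy n) t ∈ {T | bonds T (o (n + 1)) ∈ D} ↔
        ∀ k, t k ∈ {T | bonds T (o n) ∈ ![D, .univ, .univ] k} := by
    simp [bonds_glue, Fin.forall_fin_succ]
  rw [count, SG_succ, ← outer_copy, (isGluing_copy n).ncard_cornerForests_glue hS hPQ,
    Finset.sum_map]
  exact Finset.sum_congr rfl fun x _ => Fin.prod_univ_three _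

theorem mem_spanningTrees_iff {n : ℕ} {T : SimpleGraph (Vert n)} :
    T ∈ spanningTrees n ↔ T ∈ cornerForests (SG n) (corner n) Pattern.full.setoid := by
  rw [Pattern.setoid_full]
  exact and_congr_right fun _ => isTree_iff_isCornerForest

theorem mem_twoTrees_iff {n : ℕ} {T : SimpleGraph (Vert n)} :
    T ∈ twoTrees n ↔ T ∈ cornerForests (SG n) (corner n) (Pattern.sep 2).setoid := by
  have hsep : T.Reachable (o n) (a n) ∧ ¬ T.Reachable (o n) (b n) ↔
      cornerPartition T (corner n) = (Pattern.sep 2).setoid :=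
    (Pattern.eq_setoid_sep_iff (r := cornerPartition T (corner n)) (k := 2)).symm
  have hcard (h : cornerPartition T (corner n) = (Pattern.sep 2).setoid) :
      Nat.card T.ConnectedComponent = 2 ↔ ∀ v, ∃ k, T.Reachable (corner n k) v := by
    rw [← card_quotient_cornerPartition_eq_iff, h, Pattern.card_quotient_setoid, eq_comm]
    rfl
  refine and_congr_right fun _ => ⟨?_, ?_⟩
  · rintro ⟨hT, hCC, h⟩
    exact ⟨⟨hT, (hcard (hsep.1 h)).1 hCC⟩, hsep.1 h⟩
  · rintro ⟨hT, h⟩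
    exact ⟨hT.isAcyclic, (hcard h).2 hT.exists_reachable, hsep.2 h⟩

theorem numFAt_eq (j n : ℕ) : numFAt j n (o n) = count {j} n .full := by
  simp only [numFAt, mem_spanningTrees_iff]
  rfl

theorem numF_eq (n : ℕ) : numF n = count .univ n .full := by
  rw [numF, Set.ext fun _ => mem_spanningTrees_iff]
  simp [count]

theorem numGAt_eq (j n : ℕ) : numGAt j n (o n) = count {j} n (.sep 2) := by
  simp only [numGAt, mem_twoTrees_iff]
  rfl

theorem numG_eq (n : ℕ) : numG n = count .univ n (.sep 2) := by
  rw [numG, Set.ext fun _ => mem_twoTrees_iff]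
  simp [count]

end Recursion

section Totals

open Pattern

/-- `h(n)`: the number of spanning subgraphs of `SG(n)` that consist of three trees, each containing
one of the corners. -/
noncomputable def numH (n : ℕ) : ℕ := count .univ n discrete

theorem count_univ_zero (p : Pattern) : count .univ 0 p = (triangleDegrees p).card := by
  classical
  simp only [count_zero, Set.mem_univ, Multiset.countP_True]

theorem numF_zero : numF 0 = 3 := by
  rw [numF_eq, count_univ_zero, triangleDegrees_full]
  rfl

theorem numG_zero : numG 0 = 1 := by
  rw [numG_eq, count_univ_zero, triangleDegrees_sep_two]
  rfl

theorem numH_zero : numH 0 = 1 := by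
  rw [numH, count_univ_zero, triangleDegrees_discrete]
  rfl

theorem count_univ_sep (n : ℕ) (k : Fin 3) : count .univ n (sep k) = numG n := by
  rw [numG_eq]
  induction n generalizing k with
  | zero =>
    have hcard : ∀ k, (triangleDegrees (sep k)).card = 1 := by decide +kernel
    rw [count_univ_zero, count_univ_zero, hcard, hcard]
  | succ n ih =>
    fin_cases k
    · simp only [Fin.zero_eta, count_succ, Finset.sum, val_gluings_sep_zero, val_gluings_sep_two,
        ih, Multiset.insert_eq_cons, Multiset.map_cons, Multiset.map_singleton, Multiset.sum_cons,
        Multiset.sum_singleton, Matrix.cons_val]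
      ring
    · simp only [Fin.mk_one, count_succ, Finset.sum, val_gluings_sep_one, val_gluings_sep_two,
        ih, Multiset.insert_eq_cons, Multiset.map_cons, Multiset.map_singleton, Multiset.sum_cons,
        Multiset.sum_singleton, Matrix.cons_val]
      ring
    · rfl

theorem numF_succ (n : ℕ) : numF (n + 1) = 6 * numF n ^ 2 * numG n := by
  simp only [numF_eq, count_succ, Finset.sum, val_gluings_full, count_univ_sep,
    Multiset.insert_eq_cons, Multiset.map_cons, Multiset.map_singleton, Multiset.sum_cons,
    Multiset.sum_singleton, Matrix.cons_val]
  ring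

theorem numG_succ (n : ℕ) :
    numG (n + 1) = 7 * numF n * numG n ^ 2 + numF n ^ 2 * numH n := by
  rw [numG_eq, numH]
  simp only [count_succ, Finset.sum, val_gluings_sep_two, count_univ_sep, ← numF_eq,
    Multiset.insert_eq_cons, Multiset.map_cons, Multiset.map_singleton, Multiset.sum_cons,
    Multiset.sum_singleton, Matrix.cons_val]
  ring

theorem numH_succ (n : ℕ) :
    numH (n + 1) = 14 * numG n ^ 3 + 12 * numF n * numG n * numH n := by
  let countOfSize : ℕ → ℕ := fun
    | 1 => numF n
    | 2 => numG n
    | _ => numH n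
  have hcount : ∀ p, count .univ n p = countOfSize p.size := fun
    | full => (numF_eq n).symm
    | sep k => (count_univ_sep n k).trans (by fin_cases k <;> rfl)
    | discrete => rfl
  have hsum : numH (n + 1) = (((gluings discrete).val.map fun x k => (x k).size).map fun s =>
      countOfSize (s 0) * countOfSize (s 1) * countOfSize (s 2)).sum := by
    simp only [numH, count_succ, hcount, Finset.sum, Multiset.map_map, Function.comp_apply]
  rw [hsum, map_size_gluings_discrete]
  simp only [Multiset.map_add, Multiset.map_nsmul, Multiset.sum_add, Multiset.sum_nsmul,
    Multiset.insert_eq_cons, Multiset.map_cons, Multiset.map_singleton, Multiset.sum_cons,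
    Multiset.sum_singleton, Matrix.cons_val, countOfSize, smul_eq_mul]
  ring

theorem numF_mul_numH (n : ℕ) : numF n * numH n = 3 * numG n ^ 2 := by
  induction n with
  | zero => simp only [numF_zero, numG_zero, numH_zero, mul_one, one_pow]
  | succ n ih =>
    have hG : numG (n + 1) = 10 * numF n * numG n ^ 2 := by
      linear_combination numG_succ n + numF n * ih
    have hH : numH (n + 1) = 50 * numG n ^ 3 := by
      linear_combination numH_succ n + 12 * numG n * ih
    rw [numF_succ, hG, hH]
    ring

theorem numG_succ_eq (n : ℕ) : numG (n + 1) = 10 * numF n * numG n ^ 2 := by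
  linear_combination numG_succ n + numF n * numF_mul_numH n

theorem numF_pos_and_numG_pos (n : ℕ) : 0 < numF n ∧ 0 < numG n := by
  induction n with
  | zero => simp [numF_zero, numG_zero]
  | succ n ih =>
    obtain ⟨hF, hG⟩ := ih
    rw [numF_succ, numG_succ_eq]
    exact ⟨by positivity, by positivity⟩

end Totals

section Bonds

open Pattern

theorem count_sep_one (D : Set ℕ) (n : ℕ) : count D n (sep 1) = count D n (sep 2) := by
  classical
  induction n with
  | zero =>
    have hdegrees : triangleDegrees (sep 1) = triangleDegrees (sep 2) := by decide +kernel
    rw [count_zero, count_zero, hdegrees]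
  | succ n ih =>
    simp only [count_succ, Finset.sum, val_gluings_sep_one, val_gluings_sep_two, ih,
      count_univ_sep, Multiset.insert_eq_cons, Multiset.map_cons, Multiset.map_singleton,
      Multiset.sum_cons, Multiset.sum_singleton, Matrix.cons_val]
    ring

theorem numFAt_succ (j n : ℕ) : numFAt j (n + 1) (o (n + 1)) =
    4 * numFAt j n (o n) * numF n * numG n + 2 * numF n ^ 2 * numGAt j n (o n) := by
  simp only [numFAt_eq, numGAt_eq, count_succ, Finset.sum, val_gluings_full, count_sep_one,
    count_univ_sep, ← numF_eq, Multiset.insert_eq_cons, Multiset.map_cons, Multiset.map_singleton,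
    Multiset.sum_cons, Multiset.sum_singleton, Matrix.cons_val]
  ring

theorem numGAt_succ (j n : ℕ) : numGAt j (n + 1) (o (n + 1)) =
    numFAt j n (o n) * (3 * numG n ^ 2 + numF n * numH n) +
      4 * numGAt j n (o n) * numF n * numG n := by
  rw [numH]
  simp only [numFAt_eq, numGAt_eq, count_succ, Finset.sum, val_gluings_sep_two, count_sep_one,
    count_univ_sep, ← numF_eq, Multiset.insert_eq_cons, Multiset.map_cons, Multiset.map_singleton,
    Multiset.sum_cons, Multiset.sum_singleton, Matrix.cons_val]
  ring

theorem F_zero (j : ℕ) : F j 0 (o 0) = Multiset.count j {1, 1, 2} / 3 := by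
  rw [F, numFAt_eq, count_zero, triangleDegrees_full, numF_zero, Multiset.count]
  simp [eq_comm]

theorem G_zero (j : ℕ) : G j 0 (o 0) = Multiset.count j {1} := by
  rw [G, numGAt_eq, count_zero, triangleDegrees_sep_two, numG_zero, Multiset.count]
  simp [eq_comm]

theorem F_succ (j n : ℕ) :
    F j (n + 1) (o (n + 1)) = (2 * F j n (o n) + G j n (o n)) / 3 := by
  obtain ⟨hF, hG⟩ := numF_pos_and_numG_pos n
  rw [F, F, G, numFAt_succ, numF_succ]
  push_cast
  field

theorem G_succ (j n : ℕ) :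
    G j (n + 1) (o (n + 1)) = (3 * F j n (o n) + 2 * G j n (o n)) / 5 := by
  obtain ⟨hF, hG⟩ := numF_pos_and_numG_pos n
  rw [G, F, G, numGAt_succ, numF_mul_numH, numG_succ_eq]
  push_cast
  field

theorem nine_mul_F_add_five_mul_G (j n : ℕ) :
    9 * F j n (o n) + 5 * G j n (o n) = 9 * F j 0 (o 0) + 5 * G j 0 (o 0) := by
  induction n with
  | zero => rfl
  | succ n ih =>
    rw [← ih, F_succ, G_succ]
    ring

theorem F_sub_G (j n : ℕ) :
    F j n (o n) - G j n (o n) = (F j 0 (o 0) - G j 0 (o 0)) * (1 / 15) ^ n := by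
  induction n with
  | zero => rw [pow_zero, mul_one]
  | succ n ih =>
    rw [pow_succ, ← mul_assoc, ← ih, F_succ, G_succ]
    ring

end Bonds

end SierpinskiGasket

theorem mainTheorem2 (n : ℕ) :
    SierpinskiGasket.F 1 n (SierpinskiGasket.o n) = 11 / 14 - 5 / 42 * (1 / 15 : ℝ) ^ n ∧
    SierpinskiGasket.F 2 n (SierpinskiGasket.o n) = 3 / 14 + 5 / 42 * (1 / 15 : ℝ) ^ n ∧
    SierpinskiGasket.G 1 n (SierpinskiGasket.o n) = 11 / 14 + 3 / 14 * (1 / 15 : ℝ) ^ n ∧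
    SierpinskiGasket.G 2 n (SierpinskiGasket.o n) = 3 / 14 - 3 / 14 * (1 / 15 : ℝ) ^ n := by
  have hF₁ : SierpinskiGasket.F 1 0 (SierpinskiGasket.o 0) = 2 / 3 := by
    simp [SierpinskiGasket.F_zero]
  have hF₂ : SierpinskiGasket.F 2 0 (SierpinskiGasket.o 0) = 1 / 3 := by
    simp [SierpinskiGasket.F_zero]
  have hG₁ : SierpinskiGasket.G 1 0 (SierpinskiGasket.o 0) = 1 := by
    simp [SierpinskiGasket.G_zero]
  have hG₂ : SierpinskiGasket.G 2 0 (SierpinskiGasket.o 0) = 0 := by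
    simp [SierpinskiGasket.G_zero]
  have hsum₁ := SierpinskiGasket.nine_mul_F_add_five_mul_G 1 n
  have hsum₂ := SierpinskiGasket.nine_mul_F_add_five_mul_G 2 n
  have hsub₁ := SierpinskiGasket.F_sub_G 1 n
  have hsub₂ := SierpinskiGasket.F_sub_G 2 n
  rw [hF₁, hG₁] at hsum₁ hsub₁
  rw [hF₂, hG₂] at hsum₂ hsub₂
  exact ⟨by linarith, by linarith, by linarith, by linarith⟩
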